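/- An instance of MinECC consists of a finite node set $V$, a finite set (or family; parallel edges are allowed) $E$ of edges, each edge $e$ being a set of nodes, a color set $[k]=\{1,\dots,k\}$ with $k\ge 1$, a color $\ell(e)\in[k]$ and a weight $w_e\ge 0$ for every $e\in E$. A node coloring $Y:V\to[k]$ makes a mistake at $e$ if $Y(v)\neq \ell(e)$ for some $v\in e$; $\mathcal M_Y$ is the set of edges at which $Y$ makes a mistake, $\mathrm{cost}(Y)=\sum_{e\in\mathcal M_Y} w_e$, and MinECC asks for $\min_Y \mathrm{cost}(Y)$. The canonical LP relaxation is $$\min \sum_{e\in E} w_e x_e\quad\text{s.t.}\quad \sum_{i=1}^k x_v^i=k-1\ (v\in V),\quad x_e\ge x_v^{\ell(e)}\ (v\in e\in E),\quad 0\le x_v^i\le 1,\quad 0\le x_e\le 1 .$$ For an interval $I\subseteq[0,1]$, the algorithm $\mathrm{GenColorRound}(H,I)$ computes an optimal solution $x$ of this LP, draws a threshold $\rho$ uniformly from $I$ and, independently, a uniformly random permutation $\pi$ of $[k]$, and for $i=1,\dots,k$ in this order (re)colors every node $v$ with $x_v^{\pi(i)}<\rho$ by the color $\pi(i)$; nodes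 that are never colored in this loop get arbitrary colors. The output is the resulting coloring $Y$. **Theorem.** Suppose every edge has at most two nodes (the graph case, $r=2$). Then the LP has an optimal solution and, for every optimal solution $x$ used by the algorithm and every way of choosing the arbitrary colors (possibly at random and depending on $\rho$ and $\pi$), the output $Y$ of $\mathrm{GenColorRound}(H,I)$ with $I=(\tfrac12,\tfrac78)$ satisfies $$\mathbb E[\mathrm{cost}(Y)]\ \le\ \tfrac43\sum_{e\in E} w_e x_e \qquad\text{and hence}\qquad \mathbb E[\mathrm{cost}(Y)]\ \le\ \tfrac43\,\min_{Y'}\mathrm{cost}(Y').$$ That is, the algorithm is a $\tfrac43$-approximation for MinECC on graphs, in expectation, relative to the canonical LP value. -/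

import Mathlib

open MeasureTheory ProbabilityTheory

/-- An instance of MinECC: a finite weighted hypergraph with node set `V`, edges indexed by `E`,
and edge colors in the `k`-element set `Fin k`. Indexing the edges by a type allows parallel edges
(possibly of different colors). -/
structure EdgeColoredHypergraph (V E : Type*) (k : ℕ) where
  /-- the set of nodes of an edge -/
  nodes : E → Finset V
  /-- the color `ℓ(e)` of an edge -/
  color : E → Fin k
  /-- the weight `w_e` of an edge -/
  weight : E → ℝ
  weight_nonneg : ∀ e, 0 ≤ weight e

/-- Colors form a finite discrete space, and so do their permutations. -/
instance instMeasurableSpacePermFin (k : ℕ) : MeasurableSpace (Equiv.Perm (Fin k)) := ⊤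

instance instMeasurableSingletonClassPermFin (k : ℕ) :
    MeasurableSingletonClass (Equiv.Perm (Fin k)) := ⟨fun _ => trivial⟩

namespace EdgeColoredHypergraph

variable {V E : Type*} {k : ℕ}

/-- The rank: the maximum number of nodes in an edge. -/
def rank [Fintype E] (H : EdgeColoredHypergraph V E k) : ℕ :=
  Finset.univ.sup fun e => (H.nodes e).card

/-- The set of edges at which the node coloring `Y` makes a mistake. -/
def mistakes (H : EdgeColoredHypergraph V E k) (Y : V → Fin k) : Set E :=
  {e | ∃ v ∈ H.nodes e, Y v ≠ H.color e}

/-- The MinECC objective of the node coloring `Y`: the total weight of its mistakes. -/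
noncomputable def cost [Fintype E] (H : EdgeColoredHypergraph V E k) (Y : V → Fin k) : ℝ :=
  ∑ e, H.weight e * (H.mistakes Y).indicator 1 e

/-- The optimal value of MinECC. For `k ≥ 1` and finite `V` this is a minimum over a finite
nonempty set of colorings. -/
noncomputable def minECC [Fintype E] (H : EdgeColoredHypergraph V E k) : ℝ :=
  ⨅ Y : V → Fin k, H.cost Y

/-- Feasibility for the canonical LP relaxation; `x v i` is the variable of the node-color pair
`(v, i)` and `y e` is the variable of the edge `e`. -/
structure LPFeasible (H : EdgeColoredHypergraph V E k) (x : V → Fin k → ℝ) (y : E → ℝ) :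
    Prop where
  sum_eq : ∀ v, ∑ i, x v i = (k : ℝ) - 1
  node_le_edge : ∀ e, ∀ v ∈ H.nodes e, x v (H.color e) ≤ y e
  node_mem : ∀ v i, 0 ≤ x v i ∧ x v i ≤ 1
  edge_mem : ∀ e, 0 ≤ y e ∧ y e ≤ 1

/-- The objective of the canonical LP relaxation. -/
noncomputable def lpObjective [Fintype E] (H : EdgeColoredHypergraph V E k) (y : E → ℝ) : ℝ :=
  ∑ e, H.weight e * y e

/-- `(x, y)` is an optimal solution of the canonical LP relaxation. -/
def LPOptimal [Fintype E] (H : EdgeColoredHypergraph V E k) (x : V → Fin k → ℝ) (y : E → ℝ) :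
    Prop :=
  H.LPFeasible x y ∧ ∀ x' y', H.LPFeasible x' y' → H.lpObjective y ≤ H.lpObjective y'

end EdgeColoredHypergraph

/-- The rounding loop, for node-color variables `x`, threshold `ρ` and permutation `π`:
for `i = 1, …, k` in this order, every node `v` with `x v (π i) < ρ` is (re)colored with `π i`.
A node `v` that no color wants keeps the arbitrary color `d v`. -/
noncomputable def genColorRound {V : Type*} {k : ℕ} (x : V → Fin k → ℝ) (ρ : ℝ)
    (π : Equiv.Perm (Fin k)) (d : V → Fin k) : V → Fin k :=
  (List.finRange k).foldl (fun Y i v => if x v (π i) < ρ then π i else Y v) d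

/-- The law of the random choices of the algorithm: a threshold `ρ` uniform in `I` and,
independently, a uniform permutation `π` of the colors. -/
noncomputable def roundingLaw (k : ℕ) (I : Set ℝ) : Measure (ℝ × Equiv.Perm (Fin k)) :=
  (cond (volume : Measure ℝ) I).prod (uniformOn Set.univ)

/-!
Let `e` be an edge of color `c` and write `z` for its LP variable. Say that a node `v` wants a color
`i` if `x v i < ρ`. Once `z < ρ`, every node of `e` wants `c`, so there can only be a mistake at `e`
if one of the `n` rivals, the other colors that a node of `e` wants, comes after `c` in the random
order; this has probability `n / (n + 1)`. For `ρ ≤ z` the trivial bound `1` is used.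

The LP constraints give `∑ i ≠ c, (1 - x v i) = x v c ≤ z` for each node `v` of `e`. Hence
`1 - z ≤ x v i` for `i ≠ c`, and there are no rivals as long as `ρ ≤ 1 - z`. For larger `ρ`, the
concave function `n / (n + 1)` is bounded by its chord through two consecutive integers, so that
only the expected number of rivals matters. This is a sum of lengths of intervals `(x v i, 7 / 8)`,
one family of them for each of the at most two nodes, and the same constraint bounds it. Choosing
the chord according to `z` bounds the probability of a mistake at `e` by `4 / 3 * z`, and it remains
to sum over `e`.
-/

instance isProbabilityMeasure_uniformOn_univ {Ω : Type*} [Finite Ω] [Nonempty Ω]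
    [MeasurableSpace Ω] [MeasurableSingletonClass Ω] :
    IsProbabilityMeasure (uniformOn (Set.univ : Set Ω)) :=
  isProbabilityMeasure_uniformOn Set.finite_univ Set.univ_nonempty

section PermutationOrder

variable {α : Type*} [Fintype α] [LinearOrder α]

/-- The permutations, read as orders `π 0, π 1, …` of processing, in which `c` comes last among the
elements of `T`. The position of `j` in the order `π` is `π.symm j`. -/
def permsWithLast (T : Finset α) (c : α) : Finset (Equiv.Perm α) :=
  {π | ∀ j ∈ T, π.symm j ≤ π.symm c}

theorem mem_permsWithLast {T : Finset α} {c : α} {π : Equiv.Perm α} :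
    π ∈ permsWithLast T c ↔ ∀ j ∈ T, π.symm j ≤ π.symm c := by
  simp [permsWithLast]

theorem card_permsWithLast_le {T : Finset α} {c d : α} (hc : c ∈ T) (hd : d ∈ T) :
    (permsWithLast T c).card ≤ (permsWithLast T d).card := by
  refine Finset.card_le_card_of_injOn (Equiv.swap c d * ·) (fun π hπ => ?_)
    (mul_right_injective _).injOn
  simp only [Finset.mem_coe, mem_permsWithLast, Equiv.Perm.mul_def, Equiv.symm_trans_apply,
    Equiv.symm_swap, Equiv.swap_apply_right] at hπ ⊢
  refine fun j hj => hπ _ ?_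
  rw [Equiv.swap_apply_def]
  split_ifs <;> assumption

theorem card_mul_card_permsWithLast {T : Finset α} {c : α} (hc : c ∈ T) :
    T.card * (permsWithLast T c).card = (Fintype.card α).factorial := by
  have hcover : T.biUnion (permsWithLast T) = Finset.univ := by
    refine Finset.eq_univ_of_forall fun π => ?_
    obtain ⟨d, hd, hmax⟩ := T.exists_max_image π.symm ⟨c, hc⟩
    exact Finset.mem_biUnion.2 ⟨d, hd, mem_permsWithLast.2 hmax⟩
  have hdisj : (T : Set α).PairwiseDisjoint (permsWithLast T) := by
    refine fun a ha b hb hab => Finset.disjoint_left.2 fun π hπa hπb => hab ?_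
    exact π.symm.injective <|
      (mem_permsWithLast.1 hπb a ha).antisymm (mem_permsWithLast.1 hπa b hb)
  calc T.card * (permsWithLast T c).card
      = ∑ d ∈ T, (permsWithLast T d).card := by
        rw [Finset.sum_const_nat fun d hd =>
          (card_permsWithLast_le hd hc).antisymm (card_permsWithLast_le hc hd)]
    _ = (Fintype.card α).factorial := by
        rw [← Finset.card_biUnion hdisj, hcover, Finset.card_univ, Fintype.card_perm]

theorem uniformOn_real_permsWithLast [MeasurableSpace (Equiv.Perm α)]
    [MeasurableSingletonClass (Equiv.Perm α)] {T : Finset α} {c : α} (hc : c ∈ T) :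
    (uniformOn (Set.univ : Set (Equiv.Perm α))).real (permsWithLast T c) = (T.card : ℝ)⁻¹ := by
  have hcard : (T.card : ℝ) * (permsWithLast T c).card = (Fintype.card α).factorial := by
    exact_mod_cast card_mul_card_permsWithLast hc
  have hperms : ((permsWithLast T c).card : ℝ) ≠ 0 :=
    right_ne_zero_of_mul (hcard ▸ Nat.cast_ne_zero.2 (Nat.factorial_ne_zero _))
  rw [measureReal_def, uniformOn_univ, Measure.count_apply_finset, Fintype.card_perm,
    ENNReal.toReal_div, ENNReal.toReal_natCast, ENNReal.toReal_natCast, ← hcard,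
    div_mul_cancel_right₀ hperms]

end PermutationOrder

section Estimates

/-- Outside its endpoints, the line through two points of the graph of the concave function
`t ↦ t / (t + 1)` lies above the graph, and no integer lies strictly between `j` and `j + 1`. -/
theorem div_add_one_le_chord (j n : ℕ) :
    (n : ℝ) / (n + 1) ≤ j / (j + 2) + 1 / ((j + 1) * (j + 2)) * n := by
  have hprod : (0 : ℝ) ≤ ((n : ℝ) - j) * (n - (j + 1)) := by
    rcases Nat.lt_or_ge j n with h | h
    · have h' : (j : ℝ) + 1 ≤ n := by exact_mod_cast h
      exact mul_nonneg (by linarith) (by linarith)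
    · have h' : (n : ℝ) ≤ j := by exact_mod_cast h
      exact mul_nonneg_of_nonpos_of_nonpos (by linarith) (by linarith)
  have hdiff : (j : ℝ) / (j + 2) + 1 / ((j + 1) * (j + 2)) * n - n / (n + 1) =
      ((n : ℝ) - j) * (n - (j + 1)) / ((j + 1) * (j + 2) * (n + 1)) := by
    field_simp
    ring
  rw [← sub_nonneg, hdiff]
  positivity

theorem sum_max_sub_max_le {ι : Type*} {s : Finset ι} {a : ι → ℝ} {b m z : ℝ} (hb : b ≤ 1)
    (ha : ∀ i ∈ s, a i ≤ 1) (hsum : ∑ i ∈ s, (1 - a i) ≤ z) :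
    ∑ i ∈ s, max (b - max m (a i)) 0 ≤ max (max (b - m) (z - 2 * (1 - b))) 0 := by
  set J := s.filter fun i => a i < b
  have hJ : ∑ i ∈ s, max (b - max m (a i)) 0 = ∑ i ∈ J, max (b - max m (a i)) 0 := by
    refine (Finset.sum_filter_of_ne fun i _ hne => ?_).symm
    by_contra! hle
    exact hne (max_eq_right (by linarith [le_max_right m (a i)]))
  rw [hJ]
  rcases Nat.lt_or_ge 1 J.card with htwo | hone
  · refine le_max_of_le_left (le_max_of_le_right ?_)
    have hcard : (2 : ℝ) ≤ J.card := by exact_mod_cast htwo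
    calc ∑ i ∈ J, max (b - max m (a i)) 0
        ≤ ∑ i ∈ J, ((1 - a i) - (1 - b)) := Finset.sum_le_sum fun i hi =>
          max_le (by linarith [le_max_right m (a i)]) (by linarith [(Finset.mem_filter.1 hi).2])
      _ = ∑ i ∈ J, (1 - a i) - J.card * (1 - b) := by
          rw [Finset.sum_sub_distrib, Finset.sum_const, nsmul_eq_mul]
      _ ≤ z - 2 * (1 - b) := by
          have hle : ∑ i ∈ J, (1 - a i) ≤ ∑ i ∈ s, (1 - a i) :=
            Finset.sum_le_sum_of_subset_of_nonneg (Finset.filter_subset _ _)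
              fun i hi _ => sub_nonneg.2 (ha i hi)
          nlinarith
  · have hcard : (J.card : ℝ) ≤ 1 := by exact_mod_cast hone
    calc ∑ i ∈ J, max (b - max m (a i)) 0
        ≤ J.card • max (b - m) 0 := Finset.sum_le_card_nsmul _ _ _ fun i _ =>
          max_le_max_right _ (by linarith [le_max_left m (a i)])
      _ ≤ max (b - m) 0 := by
          rw [nsmul_eq_mul]
          exact mul_le_of_le_one_left (le_max_right _ _) hcard
      _ ≤ max (max (b - m) (z - 2 * (1 - b))) 0 := max_le_max_right _ (le_max_left _ _)

/-- The chord at `j = 2` serves for `z ≤ 5 / 8`, and the one at `j = 3` beyond; equality holds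
at `z = 1 / 2` and on `[5 / 8, 3 / 4]`. -/
theorem exists_chord_rounding_bound {z : ℝ} (hz₀ : 0 ≤ z) (hz : z ≤ 3 / 4) :
    ∃ j : ℕ, max (z - 1 / 2) 0 + (j : ℝ) / (j + 2) * max (7 / 8 - max z (1 - z)) 0 +
      1 / ((j + 1) * (j + 2)) * (2 * max (max (7 / 8 - max z (1 - z)) (z - 1 / 4)) 0) ≤ z / 2 := by
  rcases le_total z (1 / 2) with hhalf | hhalf
  · refine ⟨2, ?_⟩
    have hlen : max (max (7 / 8 - (1 - z)) (z - 1 / 4)) 0 = max (7 / 8 - (1 - z)) 0 := by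
      rw [max_eq_left (by linarith : z - 1 / 4 ≤ 7 / 8 - (1 - z))]
    rw [max_eq_right (by linarith : z ≤ 1 - z), max_eq_right (by linarith : z - 1 / 2 ≤ 0), hlen]
    rcases max_cases (7 / 8 - (1 - z)) 0 with ⟨h, -⟩ | ⟨h, -⟩ <;> rw [h] <;> norm_num <;> linarith
  · rw [max_eq_left (by linarith : 1 - z ≤ z), max_eq_left (by linarith : 0 ≤ z - 1 / 2),
      max_eq_left (by linarith : 0 ≤ 7 / 8 - z)]
    rcases le_total z (5 / 8) with h | h
    · refine ⟨2, ?_⟩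
      have hlen : max (max (7 / 8 - z) (z - 1 / 4)) 0 ≤ 3 / 8 :=
        max_le (max_le (by linarith) (by linarith)) (by norm_num)
      norm_num
      linarith
    · refine ⟨3, ?_⟩
      have hlen : max (max (7 / 8 - z) (z - 1 / 4)) 0 ≤ z - 1 / 4 :=
        max_le (max_le (by linarith) le_rfl) (by linarith)
      norm_num
      linarith

end Estimates

section UniformThreshold

variable {a b t : ℝ}

theorem cond_Ioo_real_Iic (hab : a < b) (htb : t < b) :
    (cond volume (Set.Ioo a b)).real (Set.Iic t) = max (t - a) 0 / (b - a) := by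
  have hinter : Set.Ioo a b ∩ Set.Iic t = Set.Ioc a t := by
    ext r
    simp only [Set.mem_inter_iff, Set.mem_Ioo, Set.mem_Iic, Set.mem_Ioc]
    grind
  rw [measureReal_def, cond_apply measurableSet_Ioo, hinter, ENNReal.toReal_mul, ENNReal.toReal_inv,
    ← measureReal_def, ← measureReal_def, Real.volume_real_Ioc,
    Real.volume_real_Ioo_of_le hab.le, inv_mul_eq_div]

theorem cond_Ioo_real_Ioi (hab : a < b) (hat : a ≤ t) :
    (cond volume (Set.Ioo a b)).real (Set.Ioi t) = max (b - t) 0 / (b - a) := by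
  have hinter : Set.Ioo a b ∩ Set.Ioi t = Set.Ioo t b := by
    ext r
    simp only [Set.mem_inter_iff, Set.mem_Ioo, Set.mem_Ioi]
    grind
  rw [measureReal_def, cond_apply measurableSet_Ioo, hinter, ENNReal.toReal_mul, ENNReal.toReal_inv,
    ← measureReal_def, ← measureReal_def, Real.volume_real_Ioo_of_le hab.le, Real.volume_real_Ioo,
    inv_mul_eq_div]

theorem isProbabilityMeasure_cond_Ioo (hab : a < b) :
    IsProbabilityMeasure (cond (volume : Measure ℝ) (Set.Ioo a b)) :=
  cond_isProbabilityMeasure_of_finite (by simpa using hab) (by simp)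

theorem isProbabilityMeasure_roundingLaw_Ioo (k : ℕ) (hab : a < b) :
    IsProbabilityMeasure (roundingLaw k (Set.Ioo a b)) := by
  have := isProbabilityMeasure_cond_Ioo hab
  exact inferInstanceAs (IsProbabilityMeasure (Measure.prod _ _))

theorem isProbabilityMeasure_of_hasLaw_roundingLaw_Ioo {Ω : Type*} [MeasurableSpace Ω]
    {P : Measure Ω} {k : ℕ} {X : Ω → ℝ × Equiv.Perm (Fin k)} (hab : a < b)
    (hlaw : HasLaw X (roundingLaw k (Set.Ioo a b)) P) : IsProbabilityMeasure P := by
  have := isProbabilityMeasure_roundingLaw_Ioo k hab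
  exact hlaw.isProbabilityMeasure

end UniformThreshold

theorem prod_real_eq_integral_real_slice {α β : Type*} [MeasurableSpace α] [MeasurableSpace β]
    {μ : Measure α} {ν : Measure β} [IsFiniteMeasure ν] {A : Set (α × β)} (hA : MeasurableSet A) :
    (μ.prod ν).real A = ∫ a, ν.real (Prod.mk a ⁻¹' A) ∂μ := by
  rw [measureReal_def, Measure.prod_apply hA, ← integral_toReal
    (measurable_measure_prodMk_left hA).aemeasurable (.of_forall fun _ => measure_lt_top _ _)]
  rfl

section RoundingLoop

variable {V : Type*} {k : ℕ}

theorem genColorRound_eq_of_last {x : V → Fin k → ℝ} {ρ : ℝ} {π : Equiv.Perm (Fin k)}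
    {d : V → Fin k} {v : V} {c : Fin k} (hc : x v c < ρ)
    (hlast : ∀ j, x v j < ρ → π.symm j ≤ π.symm c) : genColorRound x ρ π d v = c := by
  suffices hfold : ∀ (l : List (Fin k)) (Y : V → Fin k), l.Pairwise (· < ·) →
      (Y v = c ∧ (∀ i ∈ l, π.symm c < i)) ∨ π.symm c ∈ l →
      l.foldl (fun Y i v => if x v (π i) < ρ then π i else Y v) Y v = c from
    hfold _ d (List.pairwise_lt_finRange k) (Or.inr (List.mem_finRange _))
  intro l
  induction l with
  | nil => simp
  | cons i l ih =>
    intro Y hsorted hstate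
    obtain ⟨hi, hsorted⟩ := List.pairwise_cons.1 hsorted
    refine ih _ hsorted ?_
    rcases hstate with ⟨hY, hafter⟩ | hmem
    · obtain ⟨hci, hafter⟩ := List.forall_mem_cons.1 hafter
      have hnot : ¬ x v (π i) < ρ := fun hlt => (hlast _ hlt).not_gt (by simpa using hci)
      exact Or.inl ⟨(if_neg hnot).trans hY, hafter⟩
    · rcases List.mem_cons.1 hmem with rfl | hmem
      · exact Or.inl ⟨by simp [hc], hi⟩
      · exact Or.inr hmem

theorem measurable_genColorRound (x : V → Fin k → ℝ) :
    Measurable fun q : (ℝ × Equiv.Perm (Fin k)) × (V → Fin k) =>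
      genColorRound x q.1.1 q.1.2 q.2 := by
  suffices hfold : ∀ (l : List (Fin k))
      (Y : (ℝ × Equiv.Perm (Fin k)) × (V → Fin k) → V → Fin k), Measurable Y →
      Measurable fun q => l.foldl
        (fun Y i v => if x v (q.1.2 i) < q.1.1 then q.1.2 i else Y v) (Y q) from
    hfold _ _ measurable_snd
  intro l
  induction l with
  | nil => exact fun Y hY => hY
  | cons i _ ih =>
    intro Y hY
    refine ih _ (measurable_pi_iff.2 fun v => ?_)
    have heval : ∀ {β : Type} [MeasurableSpace β] (f : Fin k → β),
        Measurable fun q : (ℝ × Equiv.Perm (Fin k)) × (V → Fin k) => f (q.1.2 i) :=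
      fun f => (measurable_of_countable fun π : Equiv.Perm (Fin k) => f (π i)).comp
        (measurable_snd.comp measurable_fst)
    exact Measurable.ite (measurableSet_lt (heval (x v)) (measurable_fst.comp measurable_fst))
      (heval id) (measurable_pi_iff.1 hY v)

theorem aemeasurable_genColorRound {Ω : Type*} [MeasurableSpace Ω] {P : Measure Ω} {ρ : Ω → ℝ}
    {π : Ω → Equiv.Perm (Fin k)} {d : Ω → V → Fin k}
    (hρπ : AEMeasurable (fun ω => (ρ ω, π ω)) P) (hd : AEMeasurable d P) (x : V → Fin k → ℝ) :
    AEMeasurable (fun ω => genColorRound x (ρ ω) (π ω) (d ω)) P :=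
  (measurable_genColorRound x).comp_aemeasurable (hρπ.prodMk hd)

/-- The colors other than `c` that some node of `s` wants at threshold `ρ`, where `v` wants `j`
if `x v j < ρ`. -/
noncomputable def rivalColors (x : V → Fin k → ℝ) (s : Finset V) (c : Fin k) (ρ : ℝ) :
    Finset (Fin k) :=
  s.biUnion fun v => (Finset.univ.erase c).filter fun j => x v j < ρ

theorem mem_rivalColors {x : V → Fin k → ℝ} {s : Finset V} {c j : Fin k} {ρ : ℝ} :
    j ∈ rivalColors x s c ρ ↔ j ≠ c ∧ ∃ v ∈ s, x v j < ρ := by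
  simp only [rivalColors, Finset.mem_biUnion, Finset.mem_filter, Finset.mem_erase,
    Finset.mem_univ, and_true]
  tauto

/-- The outcomes of the threshold and the permutation for which the rounding loop gives every node
of `s` the color `c`: all of them want `c`, and `c` comes after all its rivals. -/
def safeChoices (x : V → Fin k → ℝ) (s : Finset V) (c : Fin k) :
    Set (ℝ × Equiv.Perm (Fin k)) :=
  {q | (∀ v ∈ s, x v c < q.1) ∧ q.2 ∈ permsWithLast (insert c (rivalColors x s c q.1)) c}

variable {x : V → Fin k → ℝ} {s : Finset V} {c : Fin k}

theorem genColorRound_eq_of_mem_safeChoices {ρ : ℝ} {π : Equiv.Perm (Fin k)} {d : V → Fin k}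
    (h : (ρ, π) ∈ safeChoices x s c) {v : V} (hv : v ∈ s) : genColorRound x ρ π d v = c := by
  refine genColorRound_eq_of_last (h.1 v hv) fun j hj => mem_permsWithLast.1 h.2 j ?_
  rcases eq_or_ne j c with rfl | hjc
  · exact Finset.mem_insert_self _ _
  · exact Finset.mem_insert_of_mem (mem_rivalColors.2 ⟨hjc, v, hv, hj⟩)

theorem measurableSet_safeChoices : MeasurableSet (safeChoices x s c) := by
  have hwant : ∀ v j, Measurable fun q : ℝ × Equiv.Perm (Fin k) => x v j < q.1 := fun v j =>
    measurableSet_setOfPred.1 (measurableSet_lt measurable_const measurable_fst)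
  have hbefore : ∀ j, Measurable fun q : ℝ × Equiv.Perm (Fin k) => q.2.symm j ≤ q.2.symm c :=
    fun j => (measurable_of_countable fun π : Equiv.Perm (Fin k) => π.symm j ≤ π.symm c).comp
      measurable_snd
  have hset : safeChoices x s c = {q | (∀ v : s, x v c < q.1) ∧
      ∀ j, (j ≠ c ∧ ∃ v : s, x v j < q.1) → q.2.symm j ≤ q.2.symm c} := by
    ext q
    simp [safeChoices, mem_permsWithLast, mem_rivalColors]
  rw [hset]
  exact measurableSet_setOfPred.2 <| (Measurable.forall fun v : s => hwant v c).and <|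
    Measurable.forall fun j =>
      (measurable_const.and (Measurable.exists fun v : s => hwant v j)).imp (hbefore j)

theorem uniformOn_real_slice_safeChoices_compl {r : ℝ} (hr : ∀ v ∈ s, x v c < r) :
    (uniformOn (Set.univ : Set (Equiv.Perm (Fin k)))).real (Prod.mk r ⁻¹' (safeChoices x s c)ᶜ) =
      (rivalColors x s c r).card / ((rivalColors x s c r).card + 1) := by
  have hslice : Prod.mk r ⁻¹' (safeChoices x s c)ᶜ =
      (permsWithLast (insert c (rivalColors x s c r)) c : Set (Equiv.Perm (Fin k)))ᶜ := by
    ext π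
    simp only [safeChoices, Set.mem_preimage, Set.mem_compl_iff, Set.mem_ofPred_eq,
      and_iff_right hr, Finset.mem_coe]
  have hc : c ∉ rivalColors x s c r := by simp [mem_rivalColors]
  rw [hslice, probReal_compl_eq_one_sub (Finset.measurableSet _),
    uniformOn_real_permsWithLast (Finset.mem_insert_self _ _), Finset.card_insert_of_notMem hc]
  push_cast
  field_simp
  ring

theorem uniformOn_real_slice_safeChoices_compl_le {z t : ℝ} (hc : ∀ v ∈ s, x v c ≤ z)
    (hother : ∀ v ∈ s, ∀ i ≠ c, t ≤ x v i) (j : ℕ) (r : ℝ) :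
    (uniformOn (Set.univ : Set (Equiv.Perm (Fin k)))).real (Prod.mk r ⁻¹' (safeChoices x s c)ᶜ) ≤
      (Set.Iic z).indicator 1 r + (j : ℝ) / (j + 2) * (Set.Ioi (max z t)).indicator 1 r +
        1 / ((j + 1) * (j + 2)) * ∑ v ∈ s, ∑ i ∈ Finset.univ.erase c,
          (Set.Ioi (max (max z t) (x v i))).indicator 1 r := by
  have hind : ∀ A : Set ℝ, (0 : ℝ) ≤ A.indicator 1 r := fun A =>
    Set.indicator_nonneg (fun _ _ => zero_le_one) r
  have hchord : (0 : ℝ) ≤ j / (j + 2) * (Set.Ioi (max z t)).indicator 1 r +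
      1 / ((j + 1) * (j + 2)) * ∑ v ∈ s, ∑ i ∈ Finset.univ.erase c,
        (Set.Ioi (max (max z t) (x v i))).indicator 1 r :=
    add_nonneg (mul_nonneg (by positivity) (hind _)) <| mul_nonneg (by positivity) <|
      Finset.sum_nonneg fun _ _ => Finset.sum_nonneg fun _ _ => hind _
  rw [add_assoc]
  rcases le_or_gt r z with hrz | hzr
  · rw [Set.indicator_of_mem (Set.mem_Iic.2 hrz), Pi.one_apply]
    exact measureReal_le_one.trans (le_add_of_nonneg_right hchord)
  rw [Set.indicator_of_notMem (Set.notMem_Iic.2 hzr), zero_add,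
    uniformOn_real_slice_safeChoices_compl fun v hv => (hc v hv).trans_lt hzr]
  rcases le_or_gt r t with hrt | htr
  · have hempty : rivalColors x s c r = ∅ := by
      refine Finset.eq_empty_of_forall_notMem fun i hi => ?_
      obtain ⟨hic, v, hv, hlt⟩ := mem_rivalColors.1 hi
      exact (hrt.trans (hother v hv i hic)).not_gt hlt
    simpa only [hempty, Finset.card_empty, Nat.cast_zero, zero_div] using hchord
  have hmr : max z t < r := max_lt hzr htr
  have hcard : ((rivalColors x s c r).card : ℝ) ≤ ∑ v ∈ s, ∑ i ∈ Finset.univ.erase c,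
      (Set.Ioi (max (max z t) (x v i))).indicator 1 r := by
    simp only [Set.indicator_apply, Set.mem_Ioi, max_lt_iff.trans (and_iff_right hmr),
      Pi.one_apply, Finset.sum_boole]
    exact_mod_cast Finset.card_biUnion_le
  rw [Set.indicator_of_mem (Set.mem_Ioi.2 hmr), Pi.one_apply, mul_one]
  exact (div_add_one_le_chord j _).trans <|
    add_le_add_right (mul_le_mul_of_nonneg_left hcard (by positivity)) _

theorem prod_uniformOn_real_safeChoices_compl_le {z t : ℝ} (hc : ∀ v ∈ s, x v c ≤ z)
    (hother : ∀ v ∈ s, ∀ i ≠ c, t ≤ x v i) (μ : Measure ℝ) [IsProbabilityMeasure μ] (j : ℕ) :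
    (μ.prod (uniformOn Set.univ)).real (safeChoices x s c)ᶜ ≤
      μ.real (Set.Iic z) + (j : ℝ) / (j + 2) * μ.real (Set.Ioi (max z t)) +
        1 / ((j + 1) * (j + 2)) * ∑ v ∈ s, ∑ i ∈ Finset.univ.erase c,
          μ.real (Set.Ioi (max (max z t) (x v i))) := by
  have hind : ∀ {A : Set ℝ}, MeasurableSet A → Integrable (A.indicator (1 : ℝ → ℝ)) μ :=
    fun hA => (integrable_const (1 : ℝ)).indicator hA
  have hindSum : ∀ v ∈ s, Integrable (fun r => ∑ i ∈ Finset.univ.erase c,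
      (Set.Ioi (max (max z t) (x v i))).indicator (1 : ℝ → ℝ) r) μ := fun v _ =>
    integrable_finsetSum _ fun _ _ => hind measurableSet_Ioi
  have hconst : Integrable (fun r => (Set.Iic z).indicator 1 r +
      (j : ℝ) / (j + 2) * (Set.Ioi (max z t)).indicator 1 r) μ :=
    (hind measurableSet_Iic).add ((hind measurableSet_Ioi).const_mul _)
  have hslope := (integrable_finsetSum s hindSum).const_mul (1 / (((j : ℝ) + 1) * (j + 2)))
  calc (μ.prod (uniformOn Set.univ)).real (safeChoices x s c)ᶜ
      = ∫ r, (uniformOn Set.univ).real (Prod.mk r ⁻¹' (safeChoices x s c)ᶜ) ∂μ :=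
        prod_real_eq_integral_real_slice measurableSet_safeChoices.compl
    _ ≤ ∫ r, ((Set.Iic z).indicator 1 r +
          (j : ℝ) / (j + 2) * (Set.Ioi (max z t)).indicator 1 r +
          1 / ((j + 1) * (j + 2)) * ∑ v ∈ s, ∑ i ∈ Finset.univ.erase c,
            (Set.Ioi (max (max z t) (x v i))).indicator 1 r) ∂μ :=
        integral_mono_of_nonneg (.of_forall fun _ => measureReal_nonneg) (hconst.add hslope)
          (.of_forall fun r => uniformOn_real_slice_safeChoices_compl_le hc hother j r)
    _ = _ := by
        rw [integral_add hconst hslope,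
          integral_add (hind measurableSet_Iic) ((hind measurableSet_Ioi).const_mul _),
          integral_const_mul, integral_const_mul, integral_finsetSum _ hindSum]
        simp only [integral_finsetSum _ fun _ _ => hind measurableSet_Ioi,
          integral_indicator_one measurableSet_Ioi, integral_indicator_one measurableSet_Iic]

theorem roundingLaw_Ioo_real_safeChoices_compl_le {a b z t : ℝ} (hab : a < b) (hzb : z < b)
    (hazt : a ≤ max z t) (hc : ∀ v ∈ s, x v c ≤ z) (hother : ∀ v ∈ s, ∀ i ≠ c, t ≤ x v i) (j : ℕ) :
    (roundingLaw k (Set.Ioo a b)).real (safeChoices x s c)ᶜ ≤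
      (max (z - a) 0 + (j : ℝ) / (j + 2) * max (b - max z t) 0 +
        1 / ((j + 1) * (j + 2)) * ∑ v ∈ s, ∑ i ∈ Finset.univ.erase c,
          max (b - max (max z t) (x v i)) 0) / (b - a) := by
  have := isProbabilityMeasure_cond_Ioo hab
  have hlen : ∀ v i, (ProbabilityTheory.cond volume (Set.Ioo a b)).real
      (Set.Ioi (max (max z t) (x v i))) = max (b - max (max z t) (x v i)) 0 / (b - a) :=
    fun v i => cond_Ioo_real_Ioi hab (hazt.trans (le_max_left _ _))
  refine (prod_uniformOn_real_safeChoices_compl_le hc hother _ j).trans_eq ?_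
  simp only [cond_Ioo_real_Iic hab hzb, cond_Ioo_real_Ioi hab hazt, hlen, ← Finset.sum_div]
  ring

theorem roundingLaw_real_safeChoices_compl_le_four_thirds_mul {z : ℝ} (hs : s.card ≤ 2) (hz : 0 ≤ z)
    (hle : ∀ v ∈ s, ∀ i, x v i ≤ 1) (hc : ∀ v ∈ s, x v c ≤ z)
    (hother : ∀ v ∈ s, ∑ i ∈ Finset.univ.erase c, (1 - x v i) ≤ z) :
    (roundingLaw k (Set.Ioo (1 / 2) (7 / 8))).real (safeChoices x s c)ᶜ ≤ 4 / 3 * z := by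
  have hI : (1 / 2 : ℝ) < 7 / 8 := by norm_num
  have := isProbabilityMeasure_roundingLaw_Ioo k hI
  rcases le_or_gt (3 / 4) z with hzlarge | hzsmall
  · exact measureReal_le_one.trans (by linarith)
  obtain ⟨j, hj⟩ := exists_chord_rounding_bound hz hzsmall.le
  have hm : 1 / 2 ≤ max z (1 - z) := by
    linarith [le_max_left z (1 - z), le_max_right z (1 - z)]
  have hotherOne : ∀ v ∈ s, ∀ i ≠ c, 1 - z ≤ x v i := fun v hv i hi => by
    linarith [hother v hv, Finset.single_le_sum (fun i _ => sub_nonneg.2 (hle v hv i))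
      (Finset.mem_erase.2 ⟨hi, Finset.mem_univ i⟩)]
  have hnode : ∀ v ∈ s, ∑ i ∈ Finset.univ.erase c, max (7 / 8 - max (max z (1 - z)) (x v i)) 0 ≤
      max (max (7 / 8 - max z (1 - z)) (z - 1 / 4)) 0 := by
    intro v hv
    convert sum_max_sub_max_le (m := max z (1 - z)) (by norm_num : (7 / 8 : ℝ) ≤ 1)
      (fun i _ => hle v hv i) (hother v hv) using 4
    norm_num
  have hnodes : ∑ v ∈ s, ∑ i ∈ Finset.univ.erase c, max (7 / 8 - max (max z (1 - z)) (x v i)) 0 ≤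
      2 * max (max (7 / 8 - max z (1 - z)) (z - 1 / 4)) 0 := by
    refine (Finset.sum_le_card_nsmul _ _ _ hnode).trans ?_
    rw [nsmul_eq_mul]
    exact mul_le_mul_of_nonneg_right (by exact_mod_cast hs) (le_max_right _ _)
  have hslope := mul_le_mul_of_nonneg_left hnodes
    (by positivity : (0 : ℝ) ≤ 1 / ((j + 1) * (j + 2)))
  refine (roundingLaw_Ioo_real_safeChoices_compl_le hI (by linarith) hm hc hotherOne j).trans ?_
  rw [div_le_iff₀ (by norm_num)]
  linarith

end RoundingLoop

namespace EdgeColoredHypergraph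

variable {V E : Type*} {k : ℕ} {H : EdgeColoredHypergraph V E k}

theorem card_nodes_le_rank [Fintype E] (H : EdgeColoredHypergraph V E k) (e : E) :
    (H.nodes e).card ≤ H.rank :=
  Finset.le_sup (f := fun e => (H.nodes e).card) (Finset.mem_univ e)

section LinearProgram

variable {x : V → Fin k → ℝ} {y : E → ℝ}

theorem lpFeasible_of_coloring (H : EdgeColoredHypergraph V E k) (Y : V → Fin k) :
    H.LPFeasible (fun v i => if Y v = i then 0 else 1) ((H.mistakes Y).indicator 1) where
  sum_eq v := by
    have hcompl : ∀ i, (if Y v = i then (0 : ℝ) else 1) = 1 - if Y v = i then 1 else 0 := by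
      intro i
      split_ifs <;> norm_num
    simp [hcompl, Finset.sum_sub_distrib]
  node_le_edge e v hv := by
    by_cases h : Y v = H.color e
    · rw [if_pos h]
      exact Set.indicator_nonneg (fun _ _ => zero_le_one) e
    · rw [if_neg h, Set.indicator_of_mem (show e ∈ H.mistakes Y from ⟨v, hv, h⟩), Pi.one_apply]
  node_mem v i := by split_ifs <;> norm_num
  edge_mem e :=
    ⟨Set.indicator_nonneg (fun _ _ => zero_le_one) e,
      Set.indicator_le_self' (fun _ _ => zero_le_one) e⟩

theorem isCompact_setOf_lpFeasible (H : EdgeColoredHypergraph V E k) :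
    IsCompact {q : (V → Fin k → ℝ) × (E → ℝ) | H.LPFeasible q.1 q.2} := by
  have hinter : {q : (V → Fin k → ℝ) × (E → ℝ) | H.LPFeasible q.1 q.2} =
      Set.Icc 0 1 ∩ ((⋂ v, {q | ∑ i, q.1 v i = (k : ℝ) - 1}) ∩
        ⋂ e, ⋂ v ∈ H.nodes e, {q | q.1 v (H.color e) ≤ q.2 e}) := by
    ext q
    simp only [Set.mem_inter_iff, Set.mem_iInter, Set.mem_ofPred_eq, Set.mem_Icc, Prod.le_def,
      Pi.le_def]
    exact ⟨fun h => ⟨⟨⟨fun v i => (h.node_mem v i).1, fun e => (h.edge_mem e).1⟩,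
        fun v i => (h.node_mem v i).2, fun e => (h.edge_mem e).2⟩, h.sum_eq, h.node_le_edge⟩,
      fun h => ⟨h.2.1, h.2.2, fun v i => ⟨h.1.1.1 v i, h.1.2.1 v i⟩,
        fun e => ⟨h.1.1.2 e, h.1.2.2 e⟩⟩⟩
  rw [hinter]
  exact isCompact_Icc.inter_right <|
    (isClosed_iInter fun v => isClosed_eq (by fun_prop) continuous_const).inter <|
      isClosed_iInter fun e => isClosed_iInter fun v => isClosed_iInter fun _ =>
        isClosed_le (by fun_prop) (by fun_prop)

theorem LPFeasible.sum_erase_one_sub (h : H.LPFeasible x y) (v : V) (c : Fin k) :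
    ∑ i ∈ Finset.univ.erase c, (1 - x v i) = x v c := by
  rw [Finset.sum_erase_eq_sub (Finset.mem_univ c), Finset.sum_sub_distrib, h.sum_eq]
  simp

variable [Fintype E]

theorem exists_lpOptimal (H : EdgeColoredHypergraph V E k) (hk : 1 ≤ k) :
    ∃ x y, H.LPOptimal x y := by
  obtain ⟨q, hq, hmin⟩ := H.isCompact_setOf_lpFeasible.exists_isMinOn
    ⟨(_, _), H.lpFeasible_of_coloring fun _ => ⟨0, hk⟩⟩
    (f := fun q => H.lpObjective q.2) (by unfold lpObjective; fun_prop)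
  exact ⟨q.1, q.2, hq, fun x' y' h => hmin (a := (x', y')) h⟩

theorem LPOptimal.lpObjective_le_minECC (h : H.LPOptimal x y) (hk : 1 ≤ k) :
    H.lpObjective y ≤ H.minECC := by
  have : Nonempty (V → Fin k) := ⟨fun _ => ⟨0, hk⟩⟩
  exact le_ciInf fun Y => h.2 _ _ (H.lpFeasible_of_coloring Y)

end LinearProgram

section ExpectedCost

variable {Ω : Type*} [MeasurableSpace Ω] {P : Measure Ω}

theorem measurableSet_setOf_mem_mistakes (H : EdgeColoredHypergraph V E k) (e : E) :
    MeasurableSet {Y : V → Fin k | e ∈ H.mistakes Y} := by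
  have hset : {Y : V → Fin k | e ∈ H.mistakes Y} =
      ⋃ v ∈ H.nodes e, (fun Y => Y v) ⁻¹' {H.color e}ᶜ := by
    ext Y
    simp [mistakes]
  rw [hset]
  exact Finset.measurableSet_biUnion _ fun v _ =>
    measurable_pi_apply v (measurableSet_singleton _).compl

theorem nullMeasurableSet_setOf_mem_mistakes (H : EdgeColoredHypergraph V E k)
    {Y : Ω → V → Fin k} (hY : AEMeasurable Y P) (e : E) :
    NullMeasurableSet {ω | e ∈ H.mistakes (Y ω)} P :=
  hY.nullMeasurableSet_preimage (H.measurableSet_setOf_mem_mistakes e)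

theorem integrable_indicator_mem_mistakes [IsFiniteMeasure P] (H : EdgeColoredHypergraph V E k)
    {Y : Ω → V → Fin k} (hY : AEMeasurable Y P) (e : E) :
    Integrable ({ω | e ∈ H.mistakes (Y ω)}.indicator (1 : Ω → ℝ)) P :=
  (integrable_const (1 : ℝ)).indicator₀ (H.nullMeasurableSet_setOf_mem_mistakes hY e)

variable [Fintype E]

theorem integrable_cost [IsFiniteMeasure P] (H : EdgeColoredHypergraph V E k)
    {Y : Ω → V → Fin k} (hY : AEMeasurable Y P) : Integrable (fun ω => H.cost (Y ω)) P :=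
  integrable_finsetSum _ fun e _ => (H.integrable_indicator_mem_mistakes hY e).const_mul _

theorem integral_cost [IsFiniteMeasure P] (H : EdgeColoredHypergraph V E k)
    {Y : Ω → V → Fin k} (hY : AEMeasurable Y P) :
    ∫ ω, H.cost (Y ω) ∂P = ∑ e, H.weight e * P.real {ω | e ∈ H.mistakes (Y ω)} := by
  have hindicator : ∀ e, ∫ ω, {ω | e ∈ H.mistakes (Y ω)}.indicator (1 : Ω → ℝ) ω ∂P =
      P.real {ω | e ∈ H.mistakes (Y ω)} := fun e => by
    rw [integral_indicator₀ (H.nullMeasurableSet_setOf_mem_mistakes hY e)]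
    simp
  change ∫ ω, ∑ e, H.weight e * {ω | e ∈ H.mistakes (Y ω)}.indicator (1 : Ω → ℝ) ω ∂P = _
  rw [integral_finsetSum _ fun e _ => (H.integrable_indicator_mem_mistakes hY e).const_mul _]
  simp only [integral_const_mul, hindicator]

end ExpectedCost

section Rounding

variable {x : V → Fin k → ℝ} {y : E → ℝ} {Ω : Type*} [MeasurableSpace Ω] {P : Measure Ω}
  {ρ : Ω → ℝ} {π : Ω → Equiv.Perm (Fin k)} {d : Ω → V → Fin k}

theorem LPFeasible.measureReal_mem_mistakes_genColorRound_le (h : H.LPFeasible x y) {e : E}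
    (he : (H.nodes e).card ≤ 2)
    (hlaw : HasLaw (fun ω => (ρ ω, π ω)) (roundingLaw k (Set.Ioo (1 / 2) (7 / 8))) P)
    (d : Ω → V → Fin k) :
    P.real {ω | e ∈ H.mistakes (genColorRound x (ρ ω) (π ω) (d ω))} ≤ 4 / 3 * y e := by
  have := isProbabilityMeasure_of_hasLaw_roundingLaw_Ioo (by norm_num) hlaw
  have hsub : {ω | e ∈ H.mistakes (genColorRound x (ρ ω) (π ω) (d ω))} ⊆
      {ω | (ρ ω, π ω) ∈ (safeChoices x (H.nodes e) (H.color e))ᶜ} := by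
    rintro ω ⟨v, hv, hne⟩ hsafe
    exact hne (genColorRound_eq_of_mem_safeChoices hsafe hv)
  calc P.real {ω | e ∈ H.mistakes (genColorRound x (ρ ω) (π ω) (d ω))}
      ≤ P.real {ω | (ρ ω, π ω) ∈ (safeChoices x (H.nodes e) (H.color e))ᶜ} :=
        measureReal_mono hsub
    _ = (roundingLaw k (Set.Ioo (1 / 2) (7 / 8))).real
          (safeChoices x (H.nodes e) (H.color e))ᶜ :=
        hlaw.measureReal_eq measurableSet_safeChoices.compl
    _ ≤ 4 / 3 * y e :=
        roundingLaw_real_safeChoices_compl_le_four_thirds_mul he (h.edge_mem e).1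
          (fun v _ i => (h.node_mem v i).2) (h.node_le_edge e)
          fun v hv => (h.sum_erase_one_sub v _).trans_le (h.node_le_edge e v hv)

theorem LPFeasible.integral_cost_genColorRound_le [Fintype E] (h : H.LPFeasible x y)
    (hr : H.rank ≤ 2)
    (hlaw : HasLaw (fun ω => (ρ ω, π ω)) (roundingLaw k (Set.Ioo (1 / 2) (7 / 8))) P)
    (hd : AEMeasurable d P) :
    ∫ ω, H.cost (genColorRound x (ρ ω) (π ω) (d ω)) ∂P ≤ 4 / 3 * H.lpObjective y := by
  have := isProbabilityMeasure_of_hasLaw_roundingLaw_Ioo (by norm_num) hlaw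
  rw [H.integral_cost (aemeasurable_genColorRound hlaw.aemeasurable hd x), lpObjective,
    Finset.mul_sum]
  refine Finset.sum_le_sum fun e _ => ?_
  rw [mul_left_comm]
  exact mul_le_mul_of_nonneg_left (h.measureReal_mem_mistakes_genColorRound_le
    ((H.card_nodes_le_rank e).trans hr) hlaw d) (H.weight_nonneg e)

end Rounding

end EdgeColoredHypergraph

theorem mainTheorem1_general {V E : Type*} [Fintype E] {k : ℕ} (hk : 1 ≤ k)
    (H : EdgeColoredHypergraph V E k) (hr : H.rank ≤ 2) :
    (∃ x y, H.LPOptimal x y) ∧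
    ∀ (x : V → Fin k → ℝ) (y : E → ℝ), H.LPFeasible x y →
      ∀ {Ω : Type*} [MeasurableSpace Ω] (P : Measure Ω)
        (ρ : Ω → ℝ) (π : Ω → Equiv.Perm (Fin k)) (d : Ω → V → Fin k),
        HasLaw (fun ω => (ρ ω, π ω)) (roundingLaw k (Set.Ioo (1 / 2) (7 / 8))) P →
        AEMeasurable d P →
        Integrable (fun ω => H.cost (genColorRound x (ρ ω) (π ω) (d ω))) P ∧
        ∫ ω, H.cost (genColorRound x (ρ ω) (π ω) (d ω)) ∂P ≤ 4 / 3 * H.lpObjective y ∧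
        (H.LPOptimal x y →
          ∫ ω, H.cost (genColorRound x (ρ ω) (π ω) (d ω)) ∂P ≤ 4 / 3 * H.minECC) := by
  refine ⟨H.exists_lpOptimal hk, fun x y hfeas Ω _ P ρ π d hlaw hd => ?_⟩
  have := isProbabilityMeasure_of_hasLaw_roundingLaw_Ioo (by norm_num) hlaw
  have hbound := hfeas.integral_cost_genColorRound_le hr hlaw hd
  refine ⟨H.integrable_cost (aemeasurable_genColorRound hlaw.aemeasurable hd x), hbound,
    fun hopt => hbound.trans ?_⟩
  exact mul_le_mul_of_nonneg_left (hopt.lpObjective_le_minECC hk) (by norm_num)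

theorem mainTheorem1 {V E : Type*} [Fintype V] [Fintype E] {k : ℕ} (hk : 1 ≤ k)
    (H : EdgeColoredHypergraph V E k) (hr : H.rank ≤ 2) :
    (∃ x y, H.LPOptimal x y) ∧
    ∀ (x : V → Fin k → ℝ) (y : E → ℝ), H.LPOptimal x y →
      ∀ {Ω : Type*} [MeasurableSpace Ω] (P : Measure Ω) [IsProbabilityMeasure P]
        (ρ : Ω → ℝ) (π : Ω → Equiv.Perm (Fin k)) (d : Ω → V → Fin k),
        HasLaw (fun ω => (ρ ω, π ω)) (roundingLaw k (Set.Ioo (1 / 2) (7 / 8))) P →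
        Measurable d →
        Integrable (fun ω => H.cost (genColorRound x (ρ ω) (π ω) (d ω))) P ∧
        ∫ ω, H.cost (genColorRound x (ρ ω) (π ω) (d ω)) ∂P ≤ 4 / 3 * H.lpObjective y ∧
        ∫ ω, H.cost (genColorRound x (ρ ω) (π ω) (d ω)) ∂P ≤ 4 / 3 * H.minECC :=
  (mainTheorem1_general hk H hr).imp_right fun h x y hopt _ _ P _ ρ π d hlaw hd =>
    (h x y hopt.1 P ρ π d hlaw hd.aemeasurable).imp_right (And.imp_right (· hopt))
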